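/- Let $E$ be a Euclidean space with inner product $(\cdot,\cdot)$ and let $\Phi\subset E$ be a (finite, crystallographic) irreducible reduced root system with basis (simple roots) $\Delta=\{\alpha_1,\dots,\alpha_\ell\}$. Let $\tilde\alpha=n_1\alpha_1+\cdots+n_\ell\alpha_\ell$ be the highest root, i.e. the root of maximal height, and put $\alpha_0=-\tilde\alpha$, $n_0=1$, $I=\{0,1,\dots,\ell\}$. Let $\varpi_1^\vee,\dots,\varpi_\ell^\vee\in E$ be the dual basis of $\Delta$, $(\alpha_i,\varpi_j^\vee)=\delta_{ij}$ for $1\le i,j\le\ell$, and put $\varpi_0^\vee=0$. Let $j\in I\setminus\{0\}$ with $n_j=1$. Let $w_0$ be the longest element of the Weyl group $W$, let $w_j$ be the longest element of the subgroup of $W$ generated by the simple reflections $s_{\alpha_i}$ with $i\in\{1,\dots,\ell\}\setminus\{j\}$ (length being taken with respect to these simple reflections), and let $\omega=w_jw_0$, of order $o(\omega)$. Let $E^\omega=\{x\in E:\omega(x)=x\}$ and $\phi_\omega(x)=\frac1{o(\omega)}\sum_{t=1}^{o(\omega)}\omega^t(x)$ for $x \in E$. Then there is a (necessarily unique) permutation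 $\sigma$ of $I$ with $\omega(\alpha_i)=\alpha_{\sigma(i)}$ for all $i\in I$, and $n_{\sigma(i)}=n_i$ for all $i\in I$. Let $S_0,\dots,S_r$ be the distinct orbits of $\langle\sigma\rangle$ on $I$, with $0\in S_0$. For $0\le k\le r$ let $\bar n_k$ be the common value of $n_s$ for $s\in S_k$, and put $$m_k=\frac{\#S_k\,\bar n_k}{\#S_0},\qquad \pi_k=\sum_{s\in S_k}\varpi_s^\vee .$$ Then: 1. A vector $x\in E$ lies in $E^\omega$ if and only if $(\alpha_{s_1},x)=(\alpha_{s_2},x)$ whenever $s_1,s_2\in I$ lie in the same $\langle\sigma\rangle$-orbit. 2. $\phi_\omega(\pi_k)=\pi_k-m_k\pi_0$ for all $0\le k\le r$. 3. The vectors $\bar\pi_k^\omega:=\phi_\omega(\pi_k)=\pi_k-m_k\pi_0$, $k=1,\dots,r$, form a basis of $E^\omega$. -/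

import Mathlib

namespace Folding

noncomputable section

variable {ι E : Type*} [NormedAddCommGroup E] [InnerProductSpace ℝ E]

/-- A root pairing of a real inner product space `E` with itself is Euclidean if the pairing is the
inner product and `α^∨ = 2α / (α, α)` for every root `α`. Such a pairing is a root system in `E`
in the classical sense: a family of vectors of `E` stable under the orthogonal reflections
`s_α(x) = x - (α^∨, x) α`. -/
structure IsEuclidean (P : RootPairing ι ℝ E E) : Prop where
  toLinearMap_apply : ∀ x y : E, P.toLinearMap x y = inner ℝ x y
  coroot_eq : ∀ i, P.coroot i = (2 / inner ℝ (P.root i) (P.root i)) • P.root i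

theorem IsEuclidean.reflection_apply {P : RootPairing ι ℝ E E} (hP : IsEuclidean P)
    (i : ι) (x : E) :
    P.reflection i x = x - inner ℝ (P.coroot i) x • P.root i := by
  rw [RootPairing.reflection_apply, real_inner_comm, ← hP.toLinearMap_apply]
  rfl

variable {P : RootPairing ι ℝ E E} (b : P.Base)

/-- The root with index `h` is a root of maximal height with respect to the base `b`. -/
def IsHighestRoot (h : ι) : Prop := ∀ i, b.height i ≤ b.height h

/-- The index set `I = {0, 1, …, ℓ}` of the extended Dynkin diagram: `none` is the index `0`, and
`some i` is the index of the simple root `i`. -/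
abbrev Node : Type _ := Option b.support

/-- The family `α_0 = -α̃, α_1, …, α_ℓ`, where `α̃` is the root with index `h`. -/
def extRoot (h : ι) : Node b → E
  | none => -P.root h
  | some i => P.root i

/-- The numbers `n_0 = 1, n_1, …, n_ℓ`, where `n_1, …, n_ℓ` are the coordinates of the root with
index `h` in the basis of simple roots. -/
def mark [P.IsRootSystem] (h : ι) : Node b → ℝ
  | none => 1
  | some i => b.toWeightBasis.repr (P.root h) i

variable (E) in
theorem nondegenerate_inner : LinearMap.BilinForm.Nondegenerate (innerₗ E) := by
  refine ⟨fun x hx => ?_, fun x hx => ?_⟩ <;>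
    exact inner_self_eq_zero.mp (hx x)

/-- The vectors `ϖ_0^∨ = 0, ϖ_1^∨, …, ϖ_ℓ^∨`, where `ϖ_1^∨, …, ϖ_ℓ^∨` is the basis of `E` dual to
the basis of simple roots with respect to the inner product. -/
def coweight [P.IsRootSystem] : Node b → E
  | none => 0
  | some i => by
      classical
      exact LinearMap.BilinForm.dualBasis (innerₗ E) (nondegenerate_inner E) b.toWeightBasis i

open Classical in
theorem inner_root_coweight [P.IsRootSystem] (i j : b.support) :
    inner ℝ (P.root i) (coweight b (some j)) = if i = j then 1 else 0 := by
  have h := LinearMap.BilinForm.apply_dualBasis_left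
    (nondegenerate_inner E) b.toWeightBasis j i
  rw [RootPairing.Base.toWeightBasis_apply] at h
  rw [real_inner_comm]
  exact h

/-- The subgroup of `GL(E)` generated by the simple reflections with index in `S`. -/
def parabolic (S : Set b.support) : Subgroup (E ≃ₗ[ℝ] E) :=
  Subgroup.closure ((fun i : b.support => P.reflection i) '' S)

/-- The simple reflections generate the whole Weyl group. -/
theorem parabolic_univ [Finite ι] [P.IsCrystallographic] [P.IsReduced] :
    parabolic b Set.univ = Subgroup.closure (Set.range P.reflection) := by
  have key : ∀ i : ι, P.reflection i ∈ parabolic b Set.univ := by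
    intro i
    induction i using b.induction_reflect with
    | h₀ i hi =>
      rw [P.reflection_reflectionPerm]
      exact mul_mem (mul_mem hi hi) hi
    | h₁ i hi => exact Subgroup.subset_closure ⟨⟨i, hi⟩, trivial, rfl⟩
    | h₂ i j hi hj =>
      have hj' : P.reflection j ∈ parabolic b Set.univ :=
        Subgroup.subset_closure ⟨⟨j, hj⟩, trivial, rfl⟩
      rw [P.reflection_reflectionPerm]
      exact mul_mem (mul_mem hj' hi) hj'
  refine le_antisymm (Subgroup.closure_mono ?_) ((Subgroup.closure_le _).mpr ?_)
  · rintro _ ⟨i, -, rfl⟩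
    exact ⟨i, rfl⟩
  · rintro _ ⟨i, rfl⟩
    exact key i

/-- The length of `w ∈ parabolic b S`: the least number of factors in an expression of `w` as a
product of simple reflections with index in `S`. -/
def length (S : Set b.support) (w : E ≃ₗ[ℝ] E) : ℕ :=
  sInf {n | ∃ l : List b.support, (∀ i ∈ l, i ∈ S) ∧
    (l.map fun i => P.reflection i).prod = w ∧ l.length = n}

/-- `w` is the longest element of `parabolic b S`. -/
def IsLongest (S : Set b.support) (w : E ≃ₗ[ℝ] E) : Prop :=
  w ∈ parabolic b S ∧ ∀ v ∈ parabolic b S, length b S v ≤ length b S w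

/-- The set of orbits of `⟨σ⟩` on `I`. -/
abbrev Orbit {I : Type*} (σ : Equiv.Perm I) : Type _ :=
  Quotient (Equiv.Perm.SameCycle.setoid σ)

/-- The orbit of `s` under `⟨σ⟩`. -/
def orbitOf {I : Type*} (σ : Equiv.Perm I) (s : I) : Orbit σ := Quotient.mk _ s

open Classical in
/-- The elements of an orbit. -/
def orbitSet {I : Type*} [Fintype I] (σ : Equiv.Perm I) (k : Orbit σ) : Finset I :=
  {s | orbitOf σ s = k}

/-- The number `m_k = #S_k n̄_k / #S_0`, where `n̄_k = n_s` for a representative `s` of the orbit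
`S_k`, and `S_0` is the orbit of `0`. -/
def orbitMark [P.IsRootSystem] (h : ι) (σ : Equiv.Perm (Node b)) (k : Orbit σ) : ℝ :=
  (orbitSet σ k).card * mark b h k.out / (orbitSet σ (orbitOf σ none)).card

/-- The orbit sum `π_k = ∑_{s ∈ S_k} ϖ_s^∨`. -/
def orbitSum [P.IsRootSystem] (σ : Equiv.Perm (Node b)) (k : Orbit σ) : E :=
  ∑ s ∈ orbitSet σ k, coweight b s

/-- The subspace `E^ω` of the vectors fixed by `ω`. -/
def fixedSubspace (ω : E ≃ₗ[ℝ] E) : Submodule ℝ E :=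
  LinearMap.eqLocus (ω : E →ₗ[ℝ] E) LinearMap.id

/-- The average `x^ω` of the vectors `ω^t(x)`, `1 ≤ t ≤ o(ω)`, where `o(ω)` is the order of `ω`. -/
def average (ω : E ≃ₗ[ℝ] E) (x : E) : E :=
  (1 / (orderOf ω : ℝ)) • ∑ t ∈ Finset.Icc 1 (orderOf ω), (ω ^ t) x

end

end Folding

/-! The longest element `w₀` sends every simple root to the negative of a simple root and `α̃` to
`-α̃`. The element `wj` likewise negates and permutes the simple roots other than `α_j`, and because
`n_j = 1` it exchanges `α̃` and `α_j`. Hence `ω = wj * w₀` is an isometry permuting `α_0, …, α_ℓ`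
(`exists_permutes`). The inputs are the exchange condition, which makes a longest element turn
simple roots negative, and the coordinatewise maximality of `α̃`.

The rest holds for any isometry as in `Permutes`. The relation `∑ n_i α_i = 0` is unique up to
scalars, so the marks are constant on orbits. A vector is determined by its products with the `α_i`,
so it is fixed exactly when these are constant on orbits. The number `m_k` is the constant for which
the products of `π_k - m_k π_0` depend only on the orbit, so this vector is fixed. It equals the
average of `π_k` because both have the same products with the orbit sums of the `α_i`, to which
`π_0` is orthogonal. Against the `α_i` outside `S_0` these vectors have products `0` or `1`, as a
dual basis does, and the relation then controls the product with `α_0`. -/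

namespace Folding

open Module RootPairing

/-! ### Euclidean root pairings -/

section

variable {ι E : Type*} [NormedAddCommGroup E] [InnerProductSpace ℝ E] {P : RootPairing ι ℝ E E}

theorem IsEuclidean.inner_root_pos (_hP : IsEuclidean P) (i : ι) :
    0 < inner ℝ (P.root i) (P.root i) :=
  real_inner_self_pos.mpr (P.ne_zero i)

theorem IsEuclidean.pairing_eq (hP : IsEuclidean P) (i j : ι) :
    P.pairing i j = 2 / inner ℝ (P.root j) (P.root j) * inner ℝ (P.root i) (P.root j) := by
  rw [← P.root_coroot_eq_pairing, hP.toLinearMap_apply, hP.coroot_eq, inner_smul_right]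

theorem IsEuclidean.pairing_pos_iff (hP : IsEuclidean P) (i j : ι) :
    0 < P.pairing i j ↔ 0 < inner ℝ (P.root i) (P.root j) := by
  rw [hP.pairing_eq]
  exact mul_pos_iff_of_pos_left (div_pos two_pos (hP.inner_root_pos j))

theorem IsEuclidean.pairing_nonneg_iff (hP : IsEuclidean P) (i j : ι) :
    0 ≤ P.pairing i j ↔ 0 ≤ inner ℝ (P.root i) (P.root j) := by
  rw [hP.pairing_eq]
  exact mul_nonneg_iff_of_pos_left (div_pos two_pos (hP.inner_root_pos j))

theorem pairing_pos_iff_pairingIn [P.IsCrystallographic] (i j : ι) :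
    0 < P.pairing i j ↔ 0 < P.pairingIn ℤ i j := by
  rw [← P.algebraMap_pairingIn ℤ]
  simp

theorem pairing_nonneg_iff_pairingIn [P.IsCrystallographic] (i j : ι) :
    0 ≤ P.pairing i j ↔ 0 ≤ P.pairingIn ℤ i j := by
  rw [← P.algebraMap_pairingIn ℤ]
  simp

theorem IsEuclidean.reflection_apply' (hP : IsEuclidean P) (i : ι) (x : E) :
    P.reflection i x =
      x - (2 / inner ℝ (P.root i) (P.root i) * inner ℝ (P.root i) x) • P.root i := by
  rw [hP.reflection_apply, hP.coroot_eq, real_inner_smul_left]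

theorem IsEuclidean.inner_reflection (hP : IsEuclidean P) (i : ι) (x y : E) :
    inner ℝ (P.reflection i x) (P.reflection i y) = inner ℝ x y := by
  have h := (hP.inner_root_pos i).ne'
  simp only [hP.reflection_apply', inner_sub_left, inner_sub_right, real_inner_smul_left,
    real_inner_smul_right, real_inner_comm (P.root i) x]
  field_simp
  ring

/-- An isometry carrying one root to another conjugates the reflections. -/
theorem IsEuclidean.mul_reflection (hP : IsEuclidean P) {w : E ≃ₗ[ℝ] E}
    (hw : ∀ x y, inner ℝ (w x) (w y) = inner ℝ x y) {i k : ι} (hk : w (P.root i) = P.root k) :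
    w * P.reflection i = P.reflection k * w := by
  ext x
  simp only [LinearEquiv.mul_apply, hP.reflection_apply', map_sub, map_smul, hk]
  rw [← hk, hw, hw]

end

/-! ### Words in simple reflections and the exchange condition -/

section

variable {ι E : Type*} [NormedAddCommGroup E] [InnerProductSpace ℝ E] {P : RootPairing ι ℝ E E}
  (b : P.Base)

theorem parabolic_mono {S T : Set b.support} (h : S ⊆ T) : parabolic b S ≤ parabolic b T :=
  Subgroup.closure_mono (Set.image_mono h)

theorem reflection_mem_parabolic {S : Set b.support} {i : b.support} (hi : i ∈ S) :
    P.reflection i ∈ parabolic b S :=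
  Subgroup.subset_closure ⟨i, hi, rfl⟩

/-- The product of the simple reflections named by the letters of a word. -/
def wordProd (l : List b.support) : E ≃ₗ[ℝ] E :=
  (l.map fun i : b.support => P.reflection i).prod

@[simp] theorem wordProd_nil : wordProd b [] = 1 := rfl

@[simp] theorem wordProd_cons (i : b.support) (l : List b.support) :
    wordProd b (i :: l) = P.reflection i * wordProd b l := by
  simp [wordProd]

/-- In `length` the coercion of letters to `ι` is elaborated as a monadic map over the list; this
form replaces it by `wordProd`. -/
theorem length_eq (S : Set b.support) (w : E ≃ₗ[ℝ] E) :
    length b S w = sInf {n | ∃ l : List b.support, (∀ i ∈ l, i ∈ S) ∧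
      wordProd b l = w ∧ l.length = n} := by
  have h (l : List b.support) :
      ((do let a ← l; pure (a : ι)).map fun i => P.reflection i).prod = wordProd b l := by
    induction l with
    | nil => rfl
    | cons a t ih => simpa using ih
  simp only [length, h]

theorem parabolic_induction {S : Set b.support} {p : (E ≃ₗ[ℝ] E) → Prop} (one : p 1)
    (mul : ∀ i ∈ S, ∀ w, p w → p (P.reflection i * w)) {w : E ≃ₗ[ℝ] E}
    (hw : w ∈ parabolic b S) : p w := by
  induction hw using Subgroup.closure_induction_left with
  | one => exact one
  | mul_left x hx y _ hy =>
    obtain ⟨i, hi, rfl⟩ := hx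
    exact mul i hi y hy
  | inv_mul_cancel x hx y _ hy =>
    obtain ⟨i, hi, rfl⟩ := hx
    simpa using mul i hi y hy

theorem inner_parabolic (hP : IsEuclidean P) {S : Set b.support} {w : E ≃ₗ[ℝ] E}
    (hw : w ∈ parabolic b S) : ∀ x y, inner ℝ (w x) (w y) = inner ℝ x y := by
  refine parabolic_induction b (p := fun w => ∀ x y, inner ℝ (w x) (w y) = inner ℝ x y)
    (fun _ _ => rfl) (fun i _ w h x y => ?_) hw
  simp only [LinearEquiv.mul_apply, hP.inner_reflection, h]

theorem parabolic_root {S : Set b.support} {w : E ≃ₗ[ℝ] E}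
    (hw : w ∈ parabolic b S) : ∀ i, ∃ k, w (P.root i) = P.root k := by
  refine parabolic_induction b (p := fun w => ∀ i, ∃ k, w (P.root i) = P.root k)
    (fun i => ⟨i, rfl⟩) (fun i _ w h k => ?_) hw
  obtain ⟨m, hm⟩ := h k
  exact ⟨P.reflectionPerm i m, by rw [LinearEquiv.mul_apply, hm, P.root_reflectionPerm]⟩

/-- The reflection `s_i` changes only the `i`-th coordinate. -/
theorem parabolic_repr [P.IsRootSystem] {S : Set b.support} {w : E ≃ₗ[ℝ] E}
    (hw : w ∈ parabolic b S) {j : b.support} (hj : j ∉ S) :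
    ∀ x, b.toWeightBasis.repr (w x) j = b.toWeightBasis.repr x j := by
  refine parabolic_induction b
    (p := fun w => ∀ x, b.toWeightBasis.repr (w x) j = b.toWeightBasis.repr x j)
    (fun _ => rfl) (fun i hi w h x => ?_) hw
  have hij : i ≠ j := fun h => hj (h ▸ hi)
  simp [LinearEquiv.mul_apply, P.reflection_apply, h, hij]

/-- The simple reflections are involutions, so every element of `parabolic b S` is the product of a
word in them. -/
theorem exists_word {S : Set b.support} {w : E ≃ₗ[ℝ] E} (hw : w ∈ parabolic b S) :
    ∃ l : List b.support, (∀ i ∈ l, i ∈ S) ∧ wordProd b l = w := by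
  refine parabolic_induction b
    (p := fun w => ∃ l : List b.support, (∀ i ∈ l, i ∈ S) ∧ wordProd b l = w)
    ⟨[], by simp⟩ ?_ hw
  rintro i hi _ ⟨l, hl, rfl⟩
  exact ⟨i :: l, List.forall_mem_cons.mpr ⟨hi, hl⟩, by simp⟩

theorem exists_word_length {S : Set b.support} {w : E ≃ₗ[ℝ] E} (hw : w ∈ parabolic b S) :
    ∃ l : List b.support, (∀ i ∈ l, i ∈ S) ∧
      wordProd b l = w ∧ l.length = length b S w := by
  obtain ⟨l, hl, hlw⟩ := exists_word b hw
  rw [length_eq]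
  exact Nat.sInf_mem (s := {n | ∃ l : List b.support, (∀ i ∈ l, i ∈ S) ∧
    wordProd b l = w ∧ l.length = n}) ⟨_, l, hl, hlw, rfl⟩

theorem length_prod_le {S : Set b.support} (l : List b.support) (hl : ∀ i ∈ l, i ∈ S) :
    length b S (wordProd b l) ≤ l.length := by
  rw [length_eq]
  exact Nat.sInf_le ⟨l, hl, rfl, rfl⟩

theorem word_mem_parabolic {S : Set b.support} (l : List b.support) (hl : ∀ i ∈ l, i ∈ S) :
    wordProd b l ∈ parabolic b S := by
  refine list_prod_mem fun x hx => ?_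
  obtain ⟨i, hi, rfl⟩ := List.mem_map.mp hx
  exact reflection_mem_parabolic b (hl i hi)

theorem length_inv_le {S : Set b.support} {w : E ≃ₗ[ℝ] E} (hw : w ∈ parabolic b S) :
    length b S w⁻¹ ≤ length b S w := by
  obtain ⟨l, hl, rfl, hlen⟩ := exists_word_length b hw
  have h : (wordProd b l)⁻¹ = wordProd b l.reverse := by
    simp [wordProd, List.prod_inv_reverse, List.map_reverse, Function.comp_def]
  rw [h, ← hlen, ← l.length_reverse]
  exact length_prod_le b _ (by simpa using hl)

variable {b} in
theorem IsLongest.inv {S : Set b.support} {w : E ≃ₗ[ℝ] E} (hw : IsLongest b S w) :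
    IsLongest b S w⁻¹ := by
  refine ⟨inv_mem hw.1, fun v hv => (hw.2 v hv).trans ?_⟩
  simpa using length_inv_le b (inv_mem hw.1)

/-- The exchange condition: if the product of a word sends a simple root `α_i` to a negative root,
then one letter can be deleted from the word at the cost of a factor `s_i` on the right. -/
theorem exchange [Finite ι] [P.IsCrystallographic] [P.IsReduced]
    (hP : IsEuclidean P) (i : b.support) (l : List b.support) (k : ι)
    (hk : wordProd b l (P.root i) = P.root k) (hneg : ¬ b.IsPos k) :
    ∃ l' : List b.support, (∀ a ∈ l', a ∈ l) ∧ l'.length + 1 = l.length ∧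
      wordProd b l =
        wordProd b l' * P.reflection i := by
  induction l generalizing k with
  | nil =>
    refine absurd ?_ hneg
    rw [← P.root.injective hk]
    exact Base.isPos_of_mem_support i.2
  | cons a t ih =>
    have ht := word_mem_parabolic b (S := Set.univ) t (fun _ _ => trivial)
    obtain ⟨m, hm⟩ := parabolic_root b ht i
    by_cases hpos : b.IsPos m
    -- The only positive root that `s_a` makes negative is `α_a`, so `t` sends `α_i` to `α_a`. Then
    -- `s_a t = t s_i`, and the letter to delete is `a`.
    · have hma : m = a := by
        by_contra hne
        refine hneg ?_
        have hk' : P.reflectionPerm a m = k := P.root.injective <| by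
          rw [P.root_reflectionPerm, ← hm, ← hk]
          simp
        exact hk' ▸ hpos.reflectionPerm a.2 hne
      subst hma
      exact ⟨t, fun _ => List.mem_cons_of_mem _, rfl, by
        rw [hP.mul_reflection (inner_parabolic b hP ht) hm]; simp⟩
    · obtain ⟨l', hl', hlen, hprod⟩ := ih m hm hpos
      exact ⟨a :: l', by grind, by simp [hlen], by simp [hprod, mul_assoc]⟩

variable {b}

/-- If `w α_i` were positive, `w s_i` would send `α_i` to a negative root, and exchange in a
shortest word for `w s_i` would make `w` strictly shorter than `w s_i`. -/
theorem IsLongest.not_isPos [Finite ι] [P.IsCrystallographic] [P.IsReduced]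
    (hP : IsEuclidean P) {S : Set b.support} {w : E ≃ₗ[ℝ] E}
    (hw : IsLongest b S w) {i : b.support} (hi : i ∈ S) {k : ι} (hk : w (P.root i) = P.root k) :
    ¬ b.IsPos k := by
  intro hpos
  let := P.indexNeg
  have hv := mul_mem hw.1 (reflection_mem_parabolic b hi)
  obtain ⟨l, hl, hlw, hlen⟩ := exists_word_length b hv
  obtain ⟨l', hl', hlen', hprod⟩ := exchange b hP i l (-k)
    (by rw [hlw]; simp [P.reflection_apply_self, hk])
    (by rw [Base.IsPos.neg_iff_not]; exact not_not_intro hpos)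
  rw [hlw, mul_left_inj] at hprod
  have h₁ := length_prod_le b l' (S := S) (fun a ha => hl a (hl' a ha))
  have h₂ := hw.2 _ hv
  rw [← hprod] at h₁
  omega

end

/-! ### Coordinates of roots and the action of longest elements -/

section

variable {ι E : Type*} [NormedAddCommGroup E] [InnerProductSpace ℝ E] {P : RootPairing ι ℝ E E}
  (b : P.Base)

theorem exists_repr_root [P.IsRootSystem] (i : ι) : ∃ f : b.support → ℤ,
    (0 ≤ f ∨ f ≤ 0) ∧ (∀ a, b.toWeightBasis.repr (P.root i) a = f a) ∧ b.height i = ∑ a, f a := by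
  obtain ⟨f, -, hf, hsum⟩ := b.exists_root_eq_sum_int i
  refine ⟨fun a => f a, hf.imp (fun h a => h.le a) (fun h a => h.le a), ?_, ?_⟩
  · have h : P.root i = ∑ a : b.support, (f a : ℝ) • b.toWeightBasis a := by
      rw [hsum, ← Finset.sum_coe_sort]
      simp [Int.cast_smul_eq_zsmul]
    intro a
    rw [h, Basis.repr_sum_self]
  · rw [Base.height_eq_sum hsum, ← Finset.sum_coe_sort]

theorem sum_repr_root [P.IsRootSystem] (i : ι) :
    ∑ a, b.toWeightBasis.repr (P.root i) a = b.height i := by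
  obtain ⟨f, -, hf, hs⟩ := exists_repr_root b i
  simp [hf, hs]

variable {b}

theorem repr_root_nonneg [P.IsRootSystem] {i : ι} (hi : b.IsPos i) (a : b.support) :
    0 ≤ b.toWeightBasis.repr (P.root i) a := by
  obtain ⟨f, hf, hr, hs⟩ := exists_repr_root b i
  rw [hr]
  rcases hf with hf | hf
  · exact_mod_cast hf a
  · refine absurd hi (not_lt.mpr ?_)
    rw [hs]
    exact Finset.sum_nonpos fun a _ => hf a

theorem repr_root_nonpos [P.IsRootSystem] {i : ι} (hi : ¬ b.IsPos i) (a : b.support) :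
    b.toWeightBasis.repr (P.root i) a ≤ 0 := by
  let := P.indexNeg
  have h := repr_root_nonneg ((Base.IsPos.neg_iff_not (b := b) i).mpr hi) a
  simpa using h

theorem isPos_of_repr_pos [P.IsRootSystem]
    {i : ι} {a : b.support} (h : 0 < b.toWeightBasis.repr (P.root i) a) :
    b.IsPos i := by
  by_contra hi
  exact (repr_root_nonpos hi a).not_gt h

/-- A root of height `1` is simple. -/
theorem mem_support_of_height_eq_one [Finite ι] [P.IsCrystallographic] {i : ι}
    (hi : b.height i = 1) : i ∈ b.support := by
  have hpos : b.IsPos i := by rw [Base.isPos_iff, hi]; exact one_pos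
  obtain ⟨a, ha, hai⟩ := hpos.exists_mem_support_pos_pairingIn
  rw [P.zero_lt_pairingIn_iff'] at hai
  rcases eq_or_ne i a with rfl | hne
  · exact ha
  · obtain ⟨k, hk⟩ := P.root_sub_root_mem_of_pairingIn_pos hai hne
    have h := b.height_sub hk
    rw [hi, Base.height_one_of_mem_support ha] at h
    exact absurd h (b.height_ne_zero k)

/-- The longest element of `parabolic b S` permutes the simple roots with index in `S` up to
sign. -/
theorem IsLongest.root_eq_neg [P.IsRootSystem] [Finite ι] [P.IsCrystallographic] [P.IsReduced]
    (hP : IsEuclidean P) {S : Set b.support} {w : E ≃ₗ[ℝ] E} (hw : IsLongest b S w)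
    {i : b.support} (hi : i ∈ S) : ∃ k ∈ S, w (P.root i) = -P.root k := by
  let := P.indexNeg
  obtain ⟨k, hk⟩ := parabolic_root b hw.1 i
  have hkneg := hw.not_isPos hP hi hk
  have hc (a : b.support) : 0 ≤ b.toWeightBasis.repr (P.root (-k)) a :=
    repr_root_nonneg ((Base.IsPos.neg_iff_not (b := b) k).mpr hkneg) a
  have hcS (a : b.support) (ha : a ∉ S) : b.toWeightBasis.repr (P.root (-k)) a = 0 := by
    have h := parabolic_repr b hw.1 ha (P.root i)
    have hia : i ≠ a := fun h => ha (h ▸ hi)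
    rw [hk] at h
    simpa [hia] using h
  -- Write `-w α_i = ∑ c_a α_a` with `c_a ≥ 0` supported on `S`, and apply `-w⁻¹`. As `w⁻¹` is also
  -- longest, each `-w⁻¹ α_a` with `a ∈ S` is a positive root, of height at least `1`. Comparing
  -- heights gives `∑ c_a ≤ 1`, so `-w α_i` is simple.
  have hinv : P.root i = ∑ a, b.toWeightBasis.repr (P.root (-k)) a • -(w⁻¹ (P.root a)) := by
    have h := congrArg (w⁻¹ : E ≃ₗ[ℝ] E) (b.toWeightBasis.sum_repr (P.root (-k)))
    rw [map_sum] at h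
    simp only [map_smul, Base.toWeightBasis_apply] at h
    simp only [smul_neg, Finset.sum_neg_distrib, h]
    rw [P.indexNeg_neg, P.root_reflectionPerm, P.reflection_apply_self, ← hk, map_neg, neg_neg]
    simp
  have hle : ∑ a, b.toWeightBasis.repr (P.root (-k)) a ≤ 1 := by
    calc ∑ a, b.toWeightBasis.repr (P.root (-k)) a
        ≤ ∑ a, b.toWeightBasis.repr (P.root (-k)) a *
            ∑ c, b.toWeightBasis.repr (-(w⁻¹ (P.root a))) c := by
          refine Finset.sum_le_sum fun a _ => ?_
          by_cases ha : a ∈ S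
          · refine le_mul_of_one_le_right (hc a) ?_
            obtain ⟨m, hm⟩ := parabolic_root b hw.inv.1 a
            have hmneg := hw.inv.not_isPos hP ha hm
            have h := (Base.IsPos.neg_iff_not (b := b) m).mpr hmneg
            have hm' : -(w⁻¹ (P.root a)) = P.root (-m) := by rw [hm]; simp
            rw [hm', sum_repr_root]
            exact_mod_cast h
          · rw [hcS a ha, zero_mul]
      _ = ∑ c, b.toWeightBasis.repr (P.root i) c := by
          conv_rhs => rw [hinv]
          simp only [map_sum, map_smul, Finsupp.coe_finsetSum, Finset.sum_apply, Finsupp.smul_apply,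
            smul_eq_mul, Finset.mul_sum]
          exact Finset.sum_comm
      _ = 1 := by rw [sum_repr_root, Base.height_one_of_mem_support i.2]; simp
  rw [sum_repr_root] at hle
  have hpos := (Base.IsPos.neg_iff_not (b := b) k).mpr hkneg
  rw [Base.isPos_iff] at hpos
  have hone : b.height (-k) = 1 := le_antisymm (by exact_mod_cast hle) hpos
  refine ⟨⟨-k, mem_support_of_height_eq_one hone⟩, ?_, by simp [hk]⟩
  by_contra hS
  have h := hcS _ hS
  have h' := b.toWeightBasis_repr_root ⟨-k, mem_support_of_height_eq_one hone⟩
  rw [h'] at h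
  simp at h

theorem IsLongest.repr_nonpos [P.IsRootSystem] [Finite ι] [P.IsCrystallographic] [P.IsReduced]
    (hP : IsEuclidean P) {S : Set b.support} {w : E ≃ₗ[ℝ] E} (hw : IsLongest b S w)
    {x : E} (hx : ∀ a, 0 ≤ b.toWeightBasis.repr x a)
    (hxS : ∀ a ∉ S, b.toWeightBasis.repr x a = 0) (c : b.support) :
    b.toWeightBasis.repr (w x) c ≤ 0 := by
  rw [← b.toWeightBasis.sum_repr x]
  simp only [map_sum, map_smul, Finsupp.coe_finsetSum, Finset.sum_apply, Finsupp.smul_apply,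
    smul_eq_mul]
  refine Finset.sum_nonpos fun a _ => ?_
  by_cases ha : a ∈ S
  · obtain ⟨k, -, hk⟩ := hw.root_eq_neg hP ha
    refine mul_nonpos_of_nonneg_of_nonpos (hx a) ?_
    rw [Base.toWeightBasis_apply, hk]
    have := repr_root_nonneg (b := b) (Base.isPos_of_mem_support k.2) c
    simpa using this
  · simp [hxS a ha]

end

/-! ### The highest root -/

section

variable {ι E : Type*} [NormedAddCommGroup E] [InnerProductSpace ℝ E]
  {P : RootPairing ι ℝ E E} {b : P.Base}

theorem inner_simple_nonpos [Finite ι] [P.IsCrystallographic]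
    (hP : IsEuclidean P) {a c : b.support} (h : a ≠ c) :
    inner ℝ (P.root a) (P.root c) ≤ 0 := by
  have h' := b.pairingIn_le_zero_of_ne (Subtype.coe_injective.ne h) a.2 c.2
  rwa [← not_lt, ← pairing_pos_iff_pairingIn, hP.pairing_pos_iff, not_lt] at h'

theorem inner_eq_sum [P.IsRootSystem] (x y : E) :
    inner ℝ x y = ∑ a, b.toWeightBasis.repr x a * inner ℝ (P.root a) y := by
  conv_lhs => rw [← b.toWeightBasis.sum_repr x]
  simp [sum_inner, real_inner_smul_left]

/-- A positive root to which no simple root can be added is dominant. -/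
theorem inner_nonneg_of_add_notMem [Finite ι] [P.IsCrystallographic]
    (hP : IsEuclidean P) {i : ι} (hi : b.IsPos i) {a : b.support}
    (h : P.root i + P.root a ∉ Set.range P.root) : 0 ≤ inner ℝ (P.root i) (P.root a) := by
  rw [← hP.pairing_nonneg_iff, pairing_nonneg_iff_pairingIn]
  by_contra hneg
  refine h (P.root_add_root_mem_of_pairingIn_neg (not_le.mp hneg) fun h => ?_)
  let := P.indexNeg
  have h' : i = -(a : ι) := P.root.injective (by simpa using h)
  rw [h', Base.IsPos.neg_iff_not] at hi
  exact hi (Base.isPos_of_mem_support a.2)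

theorem IsHighestRoot.isPos {h : ι} (hh : IsHighestRoot b h) : b.IsPos h := by
  let := P.indexNeg
  have h₁ := hh (-h)
  have h₂ := b.height_ne_zero h
  rw [b.height_reflectionPerm_self] at h₁
  rw [Base.isPos_iff]
  omega

theorem IsHighestRoot.inner_nonneg [Finite ι] [P.IsCrystallographic]
    (hP : IsEuclidean P) {h : ι} (hh : IsHighestRoot b h)
    (a : b.support) : 0 ≤ inner ℝ (P.root h) (P.root a) := by
  refine inner_nonneg_of_add_notMem hP hh.isPos ?_
  rintro ⟨k, hk⟩
  have h₁ := b.height_add hk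
  have h₂ := hh k
  rw [Base.height_one_of_mem_support a.2] at h₁
  omega

/-- All coordinates of the highest root are positive. -/
theorem IsHighestRoot.repr_pos [Finite ι] [P.IsRootSystem] [P.IsCrystallographic]
    [P.IsReduced] [P.IsIrreducible] (hP : IsEuclidean P) {h : ι}
    (hh : IsHighestRoot b h) (a : b.support) : 0 < b.toWeightBasis.repr (P.root h) a := by
  refine lt_of_le_of_ne (repr_root_nonneg hh.isPos a) fun ha => ?_
  -- The span of the simple roots occurring in `α̃`. If some simple root did not occur, `q` would be
  -- a proper nonzero subspace stable under all simple reflections, against irreducibility.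
  let q : Submodule ℝ E :=
    { carrier := {x | ∀ c, b.toWeightBasis.repr (P.root h) c = 0 → b.toWeightBasis.repr x c = 0}
      zero_mem' := by simp
      add_mem' := fun hx hy c hc => by simp [hx c hc, hy c hc]
      smul_mem' := fun r x hx c hc => by simp [hx c hc] }
  -- For `α_c` not occurring in `α̃`, all terms of `(α̃, α_c) = ∑ n_e (α_e, α_c)` are nonpositive
  -- while the sum is nonnegative, so every term vanishes.
  have horth (c d : b.support) (hc : b.toWeightBasis.repr (P.root h) c = 0)
      (hd : b.toWeightBasis.repr (P.root h) d ≠ 0) : inner ℝ (P.root d) (P.root c) = 0 := by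
    have hnp (e : b.support) :
        b.toWeightBasis.repr (P.root h) e * inner ℝ (P.root e) (P.root c) ≤ 0 := by
      rcases eq_or_ne e c with rfl | hec
      · simp [hc]
      · exact mul_nonpos_of_nonneg_of_nonpos (repr_root_nonneg hh.isPos e)
          (inner_simple_nonpos hP hec)
    have hsum : ∑ e, b.toWeightBasis.repr (P.root h) e * inner ℝ (P.root e) (P.root c) = 0 := by
      refine le_antisymm (Finset.sum_nonpos fun e _ => hnp e) ?_
      rw [← inner_eq_sum]
      exact hh.inner_nonneg hP c
    have h' := (Finset.sum_eq_zero_iff_of_nonpos fun e _ => hnp e).mp hsum d (Finset.mem_univ d)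
    exact (mul_eq_zero.mp h').resolve_left hd
  have hq : q = ⊤ := by
    refine IsIrreducible.eq_top_of_invtSubmodule_reflection (P := P) q ?_ ?_
    · refine (b.forall_mem_support_invtSubmodule_iff q).mp fun c hc => ?_
      lift c to b.support using hc
      refine (Module.End.mem_invtSubmodule _).mpr fun x hx d hd => ?_
      simp only [LinearEquiv.coe_coe, hP.reflection_apply', map_sub, map_smul, Finsupp.sub_apply,
        Finsupp.smul_apply, hx d hd, Base.toWeightBasis_repr_root]
      rcases eq_or_ne c d with rfl | hcd
      · have h0 : inner ℝ (P.root c) x = 0 := by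
          rw [real_inner_comm, inner_eq_sum (b := b)]
          refine Finset.sum_eq_zero fun e _ => ?_
          by_cases he : b.toWeightBasis.repr (P.root h) e = 0
          · simp [hx e he]
          · simp [horth c e hd he]
        simp [h0]
      · simp [hcd]
    · intro hq
      have hmem : P.root h ∈ q := fun _ h => h
      rw [hq, Submodule.mem_bot] at hmem
      exact P.ne_zero h hmem
  have hmem : P.root a ∈ q := hq ▸ Submodule.mem_top
  simpa using hmem a ha.symm

/-- The highest root dominates every root coordinatewise. -/
theorem IsHighestRoot.repr_le [Finite ι] [P.IsRootSystem] [P.IsCrystallographic]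
    [P.IsReduced] [P.IsIrreducible] (hP : IsEuclidean P) {h : ι}
    (hh : IsHighestRoot b h) (i : ι) (a : b.support) :
    b.toWeightBasis.repr (P.root i) a ≤ b.toWeightBasis.repr (P.root h) a := by
  induction hn : (b.height h - b.height i).toNat using Nat.strong_induction_on generalizing i with
  | _ n ih =>
  by_cases hi : b.IsPos i
  swap
  · exact (repr_root_nonpos hi a).trans (repr_root_nonneg hh.isPos a)
  -- Either a simple root can be added and the induction proceeds to a higher root, or `α_i` is
  -- dominant. In the latter case `(α̃, α_i) > 0`, so `α̃ - α_i` is zero or a root, and a root of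
  -- nonnegative height is positive.
  by_cases hadd : ∃ c : b.support, P.root i + P.root c ∈ Set.range P.root
  · obtain ⟨c, k, hk⟩ := hadd
    have h₁ := b.height_add hk
    have h₂ := hh k
    rw [Base.height_one_of_mem_support c.2] at h₁
    refine le_trans ?_ (ih _ (by omega) k rfl)
    have := repr_root_nonneg (b := b) (Base.isPos_of_mem_support c.2) a
    rw [hk]
    simpa using this
  · push Not at hadd
    have hdom (c : b.support) := inner_nonneg_of_add_notMem hP hi (hadd c)
    have hpos : 0 < inner ℝ (P.root h) (P.root i) := by
      rw [inner_eq_sum (b := b)]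
      refine Finset.sum_pos' (fun c _ => mul_nonneg (hh.repr_pos hP c).le
        (by rw [real_inner_comm]; exact hdom c)) ?_
      by_contra! hle
      have hz (c : b.support) : inner ℝ (P.root c) (P.root i) = 0 :=
        le_antisymm (nonpos_of_mul_nonpos_right (hle c (Finset.mem_univ c)) (hh.repr_pos hP c))
          (by rw [real_inner_comm]; exact hdom c)
      have h0 := hP.inner_root_pos i
      rw [inner_eq_sum (b := b)] at h0
      simp [hz] at h0
    rw [← hP.pairing_pos_iff, pairing_pos_iff_pairingIn] at hpos
    rcases eq_or_ne h i with rfl | hne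
    · exact le_rfl
    obtain ⟨k, hk⟩ := P.root_sub_root_mem_of_pairingIn_pos hpos hne
    have hkpos : b.IsPos k := by
      have h₁ := b.height_sub hk
      have h₂ := hh i
      rw [Base.isPos_iff']
      omega
    have := repr_root_nonneg hkpos a
    rw [hk] at this
    simpa using this

/-- The longest element sends the highest root to its negative. -/
theorem IsLongest.highestRoot [Finite ι] [P.IsRootSystem] [P.IsCrystallographic]
    [P.IsReduced] [P.IsIrreducible] (hP : IsEuclidean P) {h : ι}
    (hh : IsHighestRoot b h) {w : E ≃ₗ[ℝ] E} (hw : IsLongest b Set.univ w) :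
    w (P.root h) = -P.root h := by
  let := P.indexNeg
  obtain ⟨k, hk⟩ := parabolic_root b hw.1 h
  suffices hs : P.root (-k) = P.root h by
    rw [hk, ← hs]; simp
  have hle := hh.repr_le hP (-k)
  refine b.toWeightBasis.ext_elem fun a => ?_
  refine (Finset.sum_eq_sum_iff_of_le fun a _ => hle a).mp ?_ a (Finset.mem_univ a)
  -- Each `-w α_a` is simple, so `-w α̃` has the same height as `α̃`; being coordinatewise at most
  -- `α̃`, it equals `α̃`.
  have hexp : P.root (-k) = ∑ a, b.toWeightBasis.repr (P.root h) a • -(w (P.root a)) := by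
    have h' := congrArg w (b.toWeightBasis.sum_repr (P.root h))
    rw [map_sum] at h'
    simp only [map_smul, Base.toWeightBasis_apply] at h'
    simp only [smul_neg, Finset.sum_neg_distrib, h']
    simp [hk]
  rw [hexp]
  simp only [map_sum, map_smul, Finsupp.coe_finsetSum, Finset.sum_apply, Finsupp.smul_apply,
    smul_eq_mul]
  rw [Finset.sum_comm]
  refine Finset.sum_congr rfl fun a _ => ?_
  obtain ⟨m, -, hm⟩ := hw.root_eq_neg hP (Set.mem_univ a)
  rw [hm, neg_neg, ← Finset.mul_sum, sum_repr_root, Base.height_one_of_mem_support m.2]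
  simp

/-- If the simple root `α_j` has coefficient `1` in the highest root, then the longest element of
the maximal parabolic subgroup obtained by omitting `s_j` sends the highest root to `α_j`. -/
theorem IsLongest.highestRoot_eq_root [Finite ι] [P.IsRootSystem] [P.IsCrystallographic]
    [P.IsReduced] [P.IsIrreducible] (hP : IsEuclidean P) {h : ι}
    (hh : IsHighestRoot b h) {j : b.support} (hj : b.toWeightBasis.repr (P.root h) j = 1)
    {w : E ≃ₗ[ℝ] E} (hw : IsLongest b {i | i ≠ j} w) : w (P.root h) = P.root j := by
  have hjS : j ∉ ({i | i ≠ j} : Set b.support) := by simp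
  obtain ⟨k, hk⟩ := parabolic_root b hw.1 h
  have hkj : b.toWeightBasis.repr (P.root k) j = 1 := by
    rw [← hk, parabolic_repr b hw.1 hjS, hj]
  -- With `β = w⁻¹ α_j`, both `α̃` and `β` have `j`-th coordinate `1`, so `α̃ - β` is a nonnegative
  -- combination of the other simple roots. Hence `w α̃ - α_j` has nonpositive coordinates, while `w
  -- α̃` is a positive root with `j`-th coordinate `1`.
  obtain ⟨v, hv⟩ := parabolic_root b hw.inv.1 j
  have hvj : b.toWeightBasis.repr (P.root v) j = 1 := by
    rw [← hv, parabolic_repr b hw.inv.1 hjS]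
    simp
  have hwv : w (P.root v) = P.root j := by rw [← hv]; simp
  have hle (a : b.support) : b.toWeightBasis.repr (w (P.root h - P.root v)) a ≤ 0 := by
    refine hw.repr_nonpos hP (fun a => ?_) (fun a ha => ?_) a
    · simpa using hh.repr_le hP v a
    · obtain rfl : a = j := by simpa using ha
      simp [hj, hvj]
  have hkpos : b.IsPos k := isPos_of_repr_pos (a := j) (by rw [hkj]; exact one_pos)
  rw [hk]
  refine b.toWeightBasis.ext_elem fun a => ?_
  rcases eq_or_ne a j with rfl | haj
  · simp [hkj]
  · have h₁ := hle a
    rw [map_sub, hk, hwv] at h₁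
    have h₂ := repr_root_nonneg hkpos a
    simp only [map_sub, Finsupp.sub_apply, Base.toWeightBasis_repr_root,
      Finsupp.single_eq_of_ne haj] at h₁ ⊢
    linarith

end

/-! ### Extended simple roots, coweights and orbits -/

section

variable {ι E : Type*} [NormedAddCommGroup E] [InnerProductSpace ℝ E] {P : RootPairing ι ℝ E E}
  {b : P.Base}

theorem ext_inner_extRoot [P.IsRootSystem] (h : ι) {x y : E}
    (hxy : ∀ i, inner ℝ (extRoot b h i) x = inner ℝ (extRoot b h i) y) : x = y := by
  refine ext_inner_left ℝ fun z => ?_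
  rw [inner_eq_sum (b := b), inner_eq_sum (b := b)]
  exact Finset.sum_congr rfl fun a _ => congrArg _ (hxy (some a))

theorem extRoot_ext [P.IsRootSystem] {h : ι} {v w : E ≃ₗ[ℝ] E}
    (hvw : ∀ i, v (extRoot b h i) = w (extRoot b h i)) : v = w := by
  refine LinearEquiv.toLinearMap_injective (b.toWeightBasis.ext fun a => ?_)
  simpa [extRoot] using hvw (some a)

theorem sum_mark_smul_extRoot [P.IsRootSystem] (h : ι) : ∑ i, mark b h i • extRoot b h i = 0 := by
  rw [Fintype.sum_option]
  have hs := b.toWeightBasis.sum_repr (P.root h)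
  simp only [Base.toWeightBasis_apply] at hs
  simp only [mark, extRoot, hs, one_smul, neg_add_cancel]

/-- The relation `∑ n_i α_i = 0` is the only one up to scalars. -/
theorem eq_mul_mark_of_sum_eq_zero [P.IsRootSystem] {h : ι} {c : Node b → ℝ}
    (hc : ∑ i, c i • extRoot b h i = 0) (i : Node b) : c i = c none * mark b h i := by
  cases i with
  | none => simp [mark]
  | some a =>
    have hc' : ∑ a, c (some a) • b.toWeightBasis a = c none • P.root h := by
      rw [Fintype.sum_option] at hc
      simp only [extRoot, smul_neg, neg_add_eq_zero] at hc
      simpa using hc.symm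
    have h' := congrArg (fun x => b.toWeightBasis.repr x a) hc'
    simpa only [Basis.repr_sum_self, map_smul, Finsupp.smul_apply, smul_eq_mul,
      mark] using h'

/-- The conventions `n_0 = 1` and `ϖ_0^∨ = 0` let one formula cover all nodes: for `i = s = 0` the
two terms cancel. -/
theorem inner_extRoot_coweight [P.IsRootSystem] (h : ι) (i s : Node b) [DecidableEq (Node b)] :
    inner ℝ (extRoot b h i) (coweight b s) =
      (if i = s then 1 else 0) - if i = none then mark b h s else 0 := by
  classical
  cases s with
  | none => cases i <;> simp [coweight, mark]
  | some c =>
    cases i with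
    | none => simp [extRoot, mark, inner_eq_sum (b := b) (P.root h), inner_root_coweight]
    | some a => simp [extRoot, inner_root_coweight]

theorem mem_fixedSubspace {ω : E ≃ₗ[ℝ] E} {x : E} : x ∈ fixedSubspace ω ↔ ω x = x := Iff.rfl

theorem mem_orbitSet {I : Type*} [Fintype I] {σ : Equiv.Perm I} {k : Orbit σ} {s : I} :
    s ∈ orbitSet σ k ↔ orbitOf σ s = k := by
  simp [orbitSet]

theorem orbitOf_out {I : Type*} {σ : Equiv.Perm I} (k : Orbit σ) : orbitOf σ k.out = k :=
  Quotient.out_eq k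

theorem orbitOf_apply {I : Type*} (σ : Equiv.Perm I) (s : I) : orbitOf σ (σ s) = orbitOf σ s :=
  Quotient.sound (Equiv.Perm.sameCycle_apply_left.mpr (Equiv.Perm.SameCycle.refl σ s))

theorem eq_of_orbitOf_eq {I α : Type*} [Finite I] {σ : Equiv.Perm I} {f : I → α}
    (hf : ∀ i, f (σ i) = f i) {s t : I} (hst : orbitOf σ s = orbitOf σ t) : f s = f t := by
  obtain ⟨n, -, -, rfl⟩ := Equiv.Perm.SameCycle.exists_pow_eq' (Quotient.exact hst)
  clear hst
  induction n with
  | zero => rfl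
  | succ n ih => rw [pow_succ', Equiv.Perm.mul_apply, hf, ← ih]

theorem card_orbitSet_ne_zero {I : Type*} [Fintype I] {σ : Equiv.Perm I} (k : Orbit σ) :
    ((orbitSet σ k).card : ℝ) ≠ 0 := by
  exact_mod_cast (Finset.card_pos.mpr ⟨k.out, mem_orbitSet.mpr (orbitOf_out k)⟩).ne'

/-! ### Averaging over the powers of an isometry -/

section average

variable {ω : E ≃ₗ[ℝ] E}

theorem map_average (x : E) : ω (average ω x) = average ω x := by
  have hI : Finset.Icc 1 (orderOf ω) = Finset.Ico 1 (orderOf ω + 1) := by ext; simp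
  simp only [average, map_smul, map_sum, hI, Finset.sum_Ico_eq_sum_range, Nat.add_sub_cancel]
  congr 1
  have hsucc (t : ℕ) : ω ((ω ^ (1 + t)) x) = (ω ^ (1 + (t + 1))) x := by
    rw [← LinearEquiv.mul_apply, ← pow_succ', add_assoc]
  simp only [hsucc]
  -- Applying `ω` trades the first term `ω x` for `ω ^ (1 + o(ω)) x`, which is the same vector. In
  -- infinite order `orderOf ω = 0` and the average is zero.
  have h₁ := Finset.sum_range_succ (fun t => (ω ^ (1 + t)) x) (orderOf ω)
  rw [Finset.sum_range_succ' (fun t => (ω ^ (1 + t)) x) (orderOf ω), add_zero,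
    pow_add ω 1 (orderOf ω), pow_orderOf_eq_one, mul_one, pow_one] at h₁
  exact add_right_cancel h₁

theorem inner_average_of_fixed (hω : ∀ x y, inner ℝ (ω x) (ω y) = inner ℝ x y)
    (hfin : IsOfFinOrder ω) {z : E} (hz : ω z = z) (x : E) :
    inner ℝ z (average ω x) = inner ℝ z x := by
  have hpow (t : ℕ) : inner ℝ z ((ω ^ t) x) = inner ℝ z x := by
    induction t with
    | zero => rfl
    | succ t ih =>
      rw [pow_succ', LinearEquiv.mul_apply]
      conv_lhs => rw [← hz]
      rw [hω, ih]
  have h0 : (orderOf ω : ℝ) ≠ 0 := by exact_mod_cast hfin.orderOf_pos.ne'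
  rw [average, inner_smul_right, inner_sum, Finset.sum_congr rfl fun t _ => hpow t]
  simp [h0]

end average

/-- `ω` is an isometry which permutes the extended simple roots through `σ`. -/
structure Permutes (h : ι) (ω : E ≃ₗ[ℝ] E) (σ : Equiv.Perm (Node b)) : Prop where
  inner_map : ∀ x y, inner ℝ (ω x) (ω y) = inner ℝ x y
  map_extRoot : ∀ i, ω (extRoot b h i) = extRoot b h (σ i)

/-! ### Folding along an isometry that permutes the extended simple roots -/

namespace Permutes

variable {h : ι} {ω : E ≃ₗ[ℝ] E} {σ : Equiv.Perm (Node b)}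

/-- Applying `ω` to `∑ n_i α_i = 0` gives another relation, so the permuted marks are a multiple of
the marks. Both families have the same positive sum, so the factor is `1`. -/
theorem mark_eq [P.IsRootSystem] (hσ : Permutes h ω σ) (h0 : ∀ i, 0 ≤ mark b h i) (i : Node b) :
    mark b h (σ i) = mark b h i := by
  have hrel : ∑ i, mark b h (σ.symm i) • extRoot b h i = 0 := by
    rw [← Equiv.sum_comp σ]
    simp only [Equiv.symm_apply_apply, ← hσ.map_extRoot, ← map_smul, ← map_sum]
    rw [sum_mark_smul_extRoot, map_zero]
  have hmul := eq_mul_mark_of_sum_eq_zero hrel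
  have hpos : 0 < ∑ i, mark b h i :=
    Finset.sum_pos' (fun i _ => h0 i) ⟨none, Finset.mem_univ _, by simp [mark]⟩
  have hsum : ∑ i, mark b h i = mark b h (σ.symm none) * ∑ i, mark b h i := by
    rw [Finset.mul_sum, ← Finset.sum_congr rfl fun i _ => hmul i]
    exact (Equiv.sum_comp σ.symm (mark b h)).symm
  have hone : mark b h (σ.symm none) = 1 := by
    have := mul_right_cancel₀ hpos.ne' ((one_mul _).trans hsum)
    exact this.symm
  have := hmul (σ i)
  rwa [hone, one_mul, Equiv.symm_apply_apply, eq_comm] at this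

theorem isOfFinOrder [P.IsRootSystem] (hσ : Permutes h ω σ) : IsOfFinOrder ω := by
  have hpow (n : ℕ) (i : Node b) : (ω ^ n) (extRoot b h i) = extRoot b h ((σ ^ n) i) := by
    induction n with
    | zero => rfl
    | succ n ih => rw [pow_succ', pow_succ', LinearEquiv.mul_apply, ih, hσ.map_extRoot]; rfl
  refine isOfFinOrder_iff_pow_eq_one.mpr ⟨orderOf σ, orderOf_pos σ, ?_⟩
  refine extRoot_ext (b := b) (h := h) fun i => ?_
  rw [hpow, pow_orderOf_eq_one]
  rfl

theorem mem_fixedSubspace_iff [P.IsRootSystem] (hσ : Permutes h ω σ) (x : E) :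
    x ∈ fixedSubspace ω ↔
    ∀ s₁ s₂, orbitOf σ s₁ = orbitOf σ s₂ →
      inner ℝ (extRoot b h s₁) x = inner ℝ (extRoot b h s₂) x := by
  rw [mem_fixedSubspace]
  refine ⟨fun hx s₁ s₂ hs => ?_, fun hx => ext_inner_extRoot (b := b) h fun i => ?_⟩
  · refine eq_of_orbitOf_eq (f := fun s => inner ℝ (extRoot b h s) x) (fun i => ?_) hs
    conv_lhs => rw [← hσ.map_extRoot, ← hx, hσ.inner_map]
  · obtain ⟨i, rfl⟩ := σ.surjective i
    rw [hx _ _ (orbitOf_apply σ i), ← hσ.map_extRoot, hσ.inner_map]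

/-- The sum of the extended simple roots in an orbit is fixed. -/
theorem map_sum_orbit (hσ : Permutes h ω σ) (k : Orbit σ) :
    ω (∑ s ∈ orbitSet σ k, extRoot b h s) = ∑ s ∈ orbitSet σ k, extRoot b h s := by
  rw [map_sum]
  exact Finset.sum_equiv σ (fun s => by simp [mem_orbitSet, orbitOf_apply])
    fun s _ => hσ.map_extRoot s

theorem inner_sum_orbit [P.IsRootSystem]
    (hσ : Permutes h ω σ) {x : E} (hx : x ∈ fixedSubspace ω) (i : Node b) :
    inner ℝ (∑ s ∈ orbitSet σ (orbitOf σ i), extRoot b h s) x =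
      (orbitSet σ (orbitOf σ i)).card * inner ℝ (extRoot b h i) x := by
  rw [sum_inner, Finset.sum_congr rfl fun s hs =>
    (hσ.mem_fixedSubspace_iff x).mp hx s i (mem_orbitSet.mp hs)]
  simp


theorem mark_out [P.IsRootSystem] (hσ : Permutes h ω σ) (h0 : ∀ i, 0 ≤ mark b h i)
    (s : Node b) : mark b h (orbitOf σ s).out = mark b h s :=
  eq_of_orbitOf_eq (hσ.mark_eq h0) (orbitOf_out _)

open Classical in
theorem inner_orbitSum [P.IsRootSystem] (hσ : Permutes h ω σ) (h0 : ∀ i, 0 ≤ mark b h i)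
    (i : Node b) (k : Orbit σ) :
    inner ℝ (extRoot b h i) (orbitSum b σ k) = (if orbitOf σ i = k then 1 else 0) -
      if i = none then (orbitSet σ k).card * mark b h k.out else 0 := by
  have hmark : ∀ s ∈ orbitSet σ k, mark b h s = mark b h k.out := fun s hs => by
    rw [← hσ.mark_out h0 s, mem_orbitSet.mp hs]
  simp only [orbitSum, inner_sum, inner_extRoot_coweight, Finset.sum_sub_distrib]
  congr 1
  · simp [mem_orbitSet]
  · split_ifs
    · rw [Finset.sum_congr rfl hmark]
      simp
    · simp

-- At `i = 0` the extra contributions `-#S_k n̄_k` and `m_k #S_0` cancel, which is what fixes the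
-- value of `m_k`. The result depends on `i` only through its orbit.
open Classical in
theorem inner_orbitSum_sub [P.IsRootSystem] (hσ : Permutes h ω σ) (h0 : ∀ i, 0 ≤ mark b h i)
    (i : Node b) (k : Orbit σ) :
    inner ℝ (extRoot b h i)
        (orbitSum b σ k - orbitMark b h σ k • orbitSum b σ (orbitOf σ none)) =
      (if orbitOf σ i = k then 1 else 0) -
        if orbitOf σ i = orbitOf σ none then orbitMark b h σ k else 0 := by
  rw [inner_sub_right, inner_smul_right, hσ.inner_orbitSum h0, hσ.inner_orbitSum h0,
    hσ.mark_out h0]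
  have hmul : orbitMark b h σ k * (orbitSet σ (orbitOf σ none)).card =
      (orbitSet σ k).card * mark b h k.out :=
    div_mul_cancel₀ _ (card_orbitSet_ne_zero _)
  rw [← hmul]
  by_cases hi : i = none
  · subst hi
    simp [mark]
    ring
  · simp [hi]

theorem orbitSum_sub_mem [P.IsRootSystem] (hσ : Permutes h ω σ) (h0 : ∀ i, 0 ≤ mark b h i)
    (k : Orbit σ) :
    orbitSum b σ k - orbitMark b h σ k • orbitSum b σ (orbitOf σ none) ∈ fixedSubspace ω := by
  rw [hσ.mem_fixedSubspace_iff]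
  intro s t hst
  rw [hσ.inner_orbitSum_sub h0, hσ.inner_orbitSum_sub h0, hst]

/-- For the orbit of `0` the products `(α_s, π_0)` are `1`, except that `s = 0` contributes a
further `-#S_0`; on other orbits they vanish. -/
theorem inner_sum_orbit_orbitSum_none [P.IsRootSystem] (hσ : Permutes h ω σ)
    (h0 : ∀ i, 0 ≤ mark b h i) (k : Orbit σ) :
    inner ℝ (∑ s ∈ orbitSet σ k, extRoot b h s) (orbitSum b σ (orbitOf σ none)) = 0 := by
  classical
  simp only [sum_inner, hσ.inner_orbitSum h0, hσ.mark_out h0, Finset.sum_sub_distrib,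
    Finset.sum_ite_eq', mem_orbitSet]
  rw [Finset.sum_congr rfl fun s hs => by rw [mem_orbitSet.mp hs]]
  by_cases hk : orbitOf σ none = k
  · subst hk
    simp [mark]
  · simp [hk, Ne.symm hk]

/-- Both sides are fixed, so it suffices to pair them with the orbit sums of the `α_s`. These are
fixed too, so averaging does not change the pairing, and they annihilate `π_0`. -/
theorem average_orbitSum [P.IsRootSystem] (hσ : Permutes h ω σ) (h0 : ∀ i, 0 ≤ mark b h i)
    (k : Orbit σ) : average ω (orbitSum b σ k) =
    orbitSum b σ k - orbitMark b h σ k • orbitSum b σ (orbitOf σ none) := by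
  refine ext_inner_extRoot (b := b) h fun i => ?_
  refine mul_left_cancel₀ (card_orbitSet_ne_zero (orbitOf σ i)) ?_
  rw [← hσ.inner_sum_orbit (map_average _), ← hσ.inner_sum_orbit (hσ.orbitSum_sub_mem h0 k),
    inner_average_of_fixed hσ.inner_map hσ.isOfFinOrder (hσ.map_sum_orbit _), inner_sub_right,
    inner_smul_right, hσ.inner_sum_orbit_orbitSum_none h0, mul_zero, sub_zero]

/-- A fixed vector orthogonal to all extended simple roots outside the orbit of `0` vanishes. -/
theorem eq_zero_of_inner_eq_zero [P.IsRootSystem] (hσ : Permutes h ω σ) (h0 : ∀ i, 0 ≤ mark b h i)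
    {x : E} (hx : x ∈ fixedSubspace ω)
    (hxo : ∀ i, orbitOf σ i ≠ orbitOf σ none → inner ℝ (extRoot b h i) x = 0) : x = 0 := by
  classical
  have hrel := congrArg (fun y => inner ℝ y x) (sum_mark_smul_extRoot (b := b) h)
  simp only [sum_inner, real_inner_smul_left, inner_zero_left] at hrel
  have hfix := (hσ.mem_fixedSubspace_iff x).mp hx
  have hnone : inner ℝ (extRoot b h none) x = 0 := by
    -- Paired with `x`, the relation `∑ n_i α_i = 0` keeps only the orbit of `0`, where all marks
    -- are `1`, and reads `#S_0 (α_0, x) = 0`.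
    have hterm (i : Node b) : mark b h i * inner ℝ (extRoot b h i) x =
        if i ∈ orbitSet σ (orbitOf σ none) then inner ℝ (extRoot b h none) x else 0 := by
      by_cases hi : orbitOf σ i = orbitOf σ none
      · rw [if_pos (mem_orbitSet.mpr hi), hfix i none hi, ← hσ.mark_out h0 i, hi,
          hσ.mark_out h0]
        simp [mark]
      · rw [if_neg (mt mem_orbitSet.mp hi), hxo i hi, mul_zero]
    rw [Finset.sum_congr rfl fun i _ => hterm i] at hrel
    rw [Finset.sum_ite_mem, Finset.univ_inter, Finset.sum_const, nsmul_eq_mul] at hrel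
    exact (mul_eq_zero.mp hrel).resolve_left (card_orbitSet_ne_zero _)
  refine ext_inner_extRoot (b := b) h fun i => ?_
  rw [inner_zero_right]
  by_cases hi : orbitOf σ i = orbitOf σ none
  · rw [hfix i none hi, hnone]
  · exact hxo i hi

theorem exists_basis [P.IsRootSystem] (hσ : Permutes h ω σ) (h0 : ∀ i, 0 ≤ mark b h i) :
    ∃ B : Basis {k : Orbit σ // k ≠ orbitOf σ none} ℝ (fixedSubspace ω),
    ∀ k, (B k : E) = average ω (orbitSum b σ k) := by
  classical
  have := Fintype.ofFinite {k : Orbit σ // k ≠ orbitOf σ none}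
  let v (k : {k : Orbit σ // k ≠ orbitOf σ none}) : fixedSubspace ω :=
    ⟨average ω (orbitSum b σ k), map_average _⟩
  -- Pairing with `α_i`, for `i` outside `S_0`, reads off the coefficient at the orbit of `i`. This
  -- gives independence, and it dictates the coefficients `c` used for spanning.
  have hv (c : {k : Orbit σ // k ≠ orbitOf σ none} → ℝ) (i : Node b)
      (hi : orbitOf σ i ≠ orbitOf σ none) :
      inner ℝ (extRoot b h i) (∑ k, c k • v k : fixedSubspace ω).1 = c ⟨orbitOf σ i, hi⟩ := by
    have hterm (k : {k : Orbit σ // k ≠ orbitOf σ none}) :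
        inner ℝ (extRoot b h i) (v k : E) = if ⟨orbitOf σ i, hi⟩ = k then 1 else 0 := by
      simp only [v, hσ.average_orbitSum h0, hσ.inner_orbitSum_sub h0, hi, if_false, sub_zero,
        Subtype.ext_iff]
    simp [inner_sum, inner_smul_right, hterm]
  have hli : LinearIndependent ℝ v := by
    refine Fintype.linearIndependent_iff.mpr fun c hc k => ?_
    have hk : orbitOf σ k.1.out ≠ orbitOf σ none := by rw [orbitOf_out]; exact k.2
    have h' := hv c k.1.out hk
    rw [hc] at h'
    simpa [orbitOf_out] using h'.symm
  have hspan : ⊤ ≤ Submodule.span ℝ (Set.range v) := by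
    rintro x -
    let c (k : {k : Orbit σ // k ≠ orbitOf σ none}) : ℝ := inner ℝ (extRoot b h k.1.out) (x : E)
    have hx : x = ∑ k, c k • v k := by
      refine sub_eq_zero.mp (Subtype.ext ?_)
      refine hσ.eq_zero_of_inner_eq_zero h0 (x - ∑ k, c k • v k).2 fun i hi => ?_
      rw [Submodule.coe_sub, inner_sub_right, hv c i hi, sub_eq_zero]
      exact (hσ.mem_fixedSubspace_iff _).mp x.2 _ _ (orbitOf_out _).symm
    rw [hx]
    exact Submodule.sum_mem _ fun k _ => Submodule.smul_mem _ _ (Submodule.subset_span ⟨k, rfl⟩)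
  exact ⟨Basis.mk hli hspan, fun k => by rw [Basis.mk_apply]⟩

end Permutes

end

/-! ### The element `wj * w₀` permutes the extended simple roots -/

section

variable {ι E : Type*} [NormedAddCommGroup E] [InnerProductSpace ℝ E]
  {P : RootPairing ι ℝ E E} {b : P.Base}

theorem IsHighestRoot.extRoot_injective {h : ι} (hh : IsHighestRoot b h) :
    Function.Injective (extRoot b h) := by
  have hne (a : b.support) : -P.root h ≠ P.root a := fun heq => by
    let := P.indexNeg
    have hpos : b.IsPos (-h) := by
      have hha : -h = (a : ι) := P.root.injective (by simpa using heq)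
      rw [hha]
      exact Base.isPos_of_mem_support a.2
    exact (Base.IsPos.neg_iff_not (b := b) h).mp hpos hh.isPos
  rintro (_ | a) (_ | c) hac
  · rfl
  · exact absurd hac (hne c)
  · exact absurd hac.symm (hne a)
  · exact congrArg some (Subtype.ext (P.root.injective hac))

theorem IsHighestRoot.mark_nonneg [P.IsRootSystem] {h : ι} (hh : IsHighestRoot b h) (i : Node b) :
    0 ≤ mark b h i := by
  cases i with
  | none => exact zero_le_one
  | some a => exact repr_root_nonneg hh.isPos a

theorem exists_permutes [Finite ι] [P.IsRootSystem] [P.IsCrystallographic]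
    [P.IsReduced] [P.IsIrreducible] (hP : IsEuclidean P) {h : ι}
    (hh : IsHighestRoot b h) {j : b.support} (hj : mark b h (some j) = 1) {w₀ wj : E ≃ₗ[ℝ] E}
    (hw₀ : IsLongest b Set.univ w₀) (hwj : IsLongest b {i | i ≠ j} wj) :
    ∃ σ : Equiv.Perm (Node b), Permutes h (wj * w₀) σ := by
  have hmap (i : Node b) : ∃ k, (wj * w₀) (extRoot b h i) = extRoot b h k := by
    simp only [LinearEquiv.mul_apply]
    cases i with
    | none =>
      refine ⟨some j, ?_⟩
      simp [extRoot, hw₀.highestRoot hP hh, hwj.highestRoot_eq_root hP hh hj]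
    | some a =>
      obtain ⟨c, -, hc⟩ := hw₀.root_eq_neg hP (Set.mem_univ a)
      rcases eq_or_ne c j with rfl | hcj
      · refine ⟨none, ?_⟩
        -- The inverse of `wj` is also longest, so it too sends `α̃` to `α_j`; hence `wj α_j = α̃`.
        have h' := hwj.inv.highestRoot_eq_root hP hh hj
        have h'' : wj (P.root c) = P.root h := by rw [← h']; simp
        simp [extRoot, hc, h'']
      · obtain ⟨d, -, hd⟩ := hwj.root_eq_neg hP (i := c) hcj
        exact ⟨some d, by simp [extRoot, hc, hd]⟩
  choose f hf using hmap
  have hinj : Function.Injective f := fun i k hik =>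
    hh.extRoot_injective ((wj * w₀).injective (by rw [hf, hf, hik]))
  refine ⟨Equiv.ofBijective f (Finite.injective_iff_bijective.mp hinj), ?_, hf⟩
  refine inner_parabolic b hP (S := Set.univ) (mul_mem ?_ hw₀.1)
  exact parabolic_mono b (Set.subset_univ _) hwj.1

end

end Folding

open Folding in
theorem theorem3p2 {ι E : Type*} [Finite ι] [NormedAddCommGroup E] [InnerProductSpace ℝ E]
    [FiniteDimensional ℝ E] (P : RootPairing ι ℝ E E) [P.IsRootSystem] [P.IsCrystallographic]
    [P.IsReduced] [P.IsIrreducible] (hP : IsEuclidean P) (b : P.Base)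
    (h : ι) (hh : IsHighestRoot b h)
    (j : b.support) (hj : mark b h (some j) = 1)
    (w₀ wj ω : E ≃ₗ[ℝ] E) (hw₀ : IsLongest b Set.univ w₀) (hwj : IsLongest b {i | i ≠ j} wj)
    (hω : ω = wj * w₀) :
    ∃ σ : Equiv.Perm (Node b),
      (∀ i, ω (extRoot b h i) = extRoot b h (σ i)) ∧
      (∀ i, mark b h (σ i) = mark b h i) ∧
      (∀ x : E, x ∈ fixedSubspace ω ↔
        ∀ s₁ s₂, orbitOf σ s₁ = orbitOf σ s₂ →
          inner ℝ (extRoot b h s₁) x = inner ℝ (extRoot b h s₂) x) ∧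
      (∀ k : Orbit σ, average ω (orbitSum b σ k) =
        orbitSum b σ k - orbitMark b h σ k • orbitSum b σ (orbitOf σ none)) ∧
      ∃ B : Module.Basis {k : Orbit σ // k ≠ orbitOf σ none} ℝ (fixedSubspace ω),
        ∀ k, (B k : E) = average ω (orbitSum b σ k) := by
  subst hω
  obtain ⟨σ, hσ⟩ := exists_permutes hP hh hj hw₀ hwj
  exact ⟨σ, hσ.map_extRoot, hσ.mark_eq hh.mark_nonneg, hσ.mem_fixedSubspace_iff,
    hσ.average_orbitSum hh.mark_nonneg, hσ.exists_basis hh.mark_nonneg⟩
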